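/- Consider a radix-$2$ floating-point (FP) system of precision $p$ with exponent range $[e_{\min},e_{\max}]$: its numbers are $M\cdot 2^{e-p+1}$ with $M,e\in\mathbb Z$, $|M|\le 2^p-1$, $e_{\min}\le e\le e_{\max}$. Let $u=2^{-p}$ be the unit round-off, $\Omega=(2^p-1)2^{e_{\max}-p+1}$ the largest FP number, and let $\mathrm{RN}$ be rounding to nearest, with any tie-breaking rule. Given FP numbers $x,y$, not both zero, Beebe's algorithm (with a fused multiply-add) swaps $x$ and $y$ if $|x|<|y|$ and then computes $$r=\mathrm{RN}(y/x),\quad t=\mathrm{RN}(1+r^2),\quad s=\mathrm{RN}(\sqrt t),\quad \epsilon=\mathrm{RN}(t-s^2),$$ $$c=\mathrm{RN}(\epsilon/(2s)),\quad \nu=\mathrm{RN}(|x|\cdot c),\quad \rho=\mathrm{RN}(|x|\cdot s+\nu).$$ Assume that $u\le 1/16$ (i.e., $p\ge 4$) and that no underflow or overflow occurs, i.e., each of the seven rounded quantities $z$ is itself an FP number or satisfies $2^{e_{\min}}\le |z|\le\Omega$. Then the relative error satisfies $$\frac{\bigl|\rho-\sqrt{x^2+y^2}\bigr|}{\sqrt{x^2+y^2}}\le\chi_4(u),$$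 where $$\chi_4(u)=(1+2u)\sqrt{\frac{1+u/5}{1+u}}-1+u^2\frac{(1+2u)^2}{(1+u)^2}\left(\frac{\sqrt5}{5}+\frac{1}{\frac52\sqrt{(1+u)(1+\frac u5)}-\sqrt5\,u}+\frac{2\sqrt5}{5(1+2u)}\right).$$ Moreover, $$\chi_4(u)=\frac85u+\left(\frac{3\sqrt5}{5}-\frac2{25}\right)u^2+\left(\frac{116}{125}+\frac{14\sqrt5}{25}\right)u^3+O(u^4)\qquad(u\to0),$$ $\chi_4(u)\le\frac85u+\frac75u^2$ for all $u\in[0,1/16]$, and $\chi_4$ is (strictly) increasing on $[0,1/16]$. -/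

import Mathlib

open Filter Topology Asymptotics

noncomputable section

/-- The parameters of a radix-2 floating-point system: precision and extremal exponents. -/
structure FPFormat where
  /-- the precision `p` -/
  prec : ℕ
  /-- the minimal exponent -/
  emin : ℤ
  /-- the maximal exponent -/
  emax : ℤ

namespace FPFormat

/-- The finite floating-point numbers `M * 2 ^ (e - p + 1)`, with `|M| ≤ 2 ^ p - 1` and
`emin ≤ e ≤ emax` (normal and subnormal numbers, and zero). -/
def numbers (F : FPFormat) : Set ℝ :=
  {x | ∃ M e : ℤ, |M| ≤ 2 ^ F.prec - 1 ∧ F.emin ≤ e ∧ e ≤ F.emax ∧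
    x = (M : ℝ) * (2 : ℝ) ^ (e - (F.prec : ℤ) + 1)}

/-- The unit round-off `u = 2 ^ (-p)`. -/
def unitRoundoff (F : FPFormat) : ℝ := (2 : ℝ) ^ (-(F.prec : ℤ))

/-- The largest finite floating-point number `(2 ^ p - 1) * 2 ^ (emax - p + 1)`. -/
def maxFinite (F : FPFormat) : ℝ :=
  ((2 : ℝ) ^ F.prec - 1) * (2 : ℝ) ^ (F.emax - (F.prec : ℤ) + 1)

/-- `RN` is a round-to-nearest function: it sends every real number to a floating-point number
at minimal distance. The rule for breaking ties is arbitrary. -/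
def IsRoundToNearest (F : FPFormat) (RN : ℝ → ℝ) : Prop :=
  ∀ z : ℝ, RN z ∈ F.numbers ∧ ∀ f ∈ F.numbers, |z - RN z| ≤ |z - f|

/-- An operation with exact result `z` neither underflows nor overflows: either `z` is a
floating-point number (in particular `z = 0`), so that no rounding occurs, or `z` lies in the
normal domain. -/
def NoUnderOverflow (F : FPFormat) (z : ℝ) : Prop :=
  z ∈ F.numbers ∨ ((2 : ℝ) ^ F.emin ≤ |z| ∧ |z| ≤ F.maxFinite)

end FPFormat

namespace Beebe

/-! The steps of Beebe's algorithm after the swap, for operands with `|y| ≤ |x|`. The steps for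
`t`, `ε` and `ρ` are fused multiply-adds: a single rounding of `a * b + c`. -/

/-- `r ← RN(y / x)` -/
def r (RN : ℝ → ℝ) (x y : ℝ) : ℝ := RN (y / x)

/-- `t ← RN(1 + r²)` -/
def t (RN : ℝ → ℝ) (x y : ℝ) : ℝ := RN (1 + r RN x y ^ 2)

/-- `s ← RN(√t)` -/
def s (RN : ℝ → ℝ) (x y : ℝ) : ℝ := RN (√(t RN x y))

/-- `ε ← RN(t - s²)` -/
def ε (RN : ℝ → ℝ) (x y : ℝ) : ℝ := RN (t RN x y - s RN x y ^ 2)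

/-- `c ← RN(ε / (2 s))` -/
def c (RN : ℝ → ℝ) (x y : ℝ) : ℝ := RN (ε RN x y / (2 * s RN x y))

/-- `ν ← RN(|x| c)` -/
def ν (RN : ℝ → ℝ) (x y : ℝ) : ℝ := RN (|x| * c RN x y)

/-- `ρ ← RN(|x| s + ν)` -/
def ρ (RN : ℝ → ℝ) (x y : ℝ) : ℝ := RN (|x| * s RN x y + ν RN x y)

/-- No operation underflows or overflows in the steps after the swap. -/
def StepsSafe (F : FPFormat) (RN : ℝ → ℝ) (x y : ℝ) : Prop :=
  F.NoUnderOverflow (y / x) ∧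
  F.NoUnderOverflow (1 + r RN x y ^ 2) ∧
  F.NoUnderOverflow (√(t RN x y)) ∧
  F.NoUnderOverflow (t RN x y - s RN x y ^ 2) ∧
  F.NoUnderOverflow (ε RN x y / (2 * s RN x y)) ∧
  F.NoUnderOverflow (|x| * c RN x y) ∧
  F.NoUnderOverflow (|x| * s RN x y + ν RN x y)

/-- The result of Beebe's algorithm on the inputs `x`, `y`, which are swapped if `|x| < |y|`. -/
def hypot (RN : ℝ → ℝ) (x y : ℝ) : ℝ :=
  if |x| < |y| then ρ RN y x else ρ RN x y

/-- No operation underflows or overflows when Beebe's algorithm is run on `x`, `y`. -/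
def Safe (F : FPFormat) (RN : ℝ → ℝ) (x y : ℝ) : Prop :=
  if |x| < |y| then StepsSafe F RN y x else StepsSafe F RN x y

/-- The error bound, as a function of the unit round-off. -/
def χ₄ (u : ℝ) : ℝ :=
  (1 + 2 * u) * √((1 + u / 5) / (1 + u)) - 1 +
    u ^ 2 * ((1 + 2 * u) ^ 2 / (1 + u) ^ 2) *
      (√5 / 5 + 1 / (5 * √((1 + u) * (1 + u / 5)) / 2 - √5 * u) +
        2 * √5 / (5 * (1 + 2 * u)))

end Beebe

end

/-! Put `q = y / x` with `|q| ≤ 1`, and `v = √(1 + q²)`, so that the exact result is `|x| v`. The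
rounding of `q` has error at most `u/2`, or `u/4` when `|q| < 1/2`, and that of `1 + r²` at most
`u`. When `|q| ≥ 1/2` the relative error of `t` is therefore at most `(6u + u²)/5`, the worst case
being `|q| = 1/2`; since `1 + (6u + u²)/5 = (1 + u)(1 + u/5)`, this gives `√t ≤ σ u * v`. The
residual `t - s²` is computed exactly, and `s + (t - s²)/(2s)` is a Newton step for `√t`, whose
error is `(√t - s)²/(2s)`. So the rounding of the square root, of order `u`, is replaced by terms of
order `u²`: the Newton error, the rounding of `c`, and that of `ν`. Together they make up `core`,
and the last rounding multiplies by at most `1 + u/(1+u) = (1+2u)/(1+u)`, which gives `1 + χ₄ u`.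
The range `|q| < 1/2` and the error from below need only cruder estimates: the first has room at
first order, the second at order `u²`. The main lemmas are `sqrt_residual_exact`, `c_bounds`,
`core_bound_of_half_le` and `one_sub_χ₄_le`. -/

namespace FPFormat

/-! ### Rounding to nearest: absolute and relative errors -/

variable {F : FPFormat} {RN : ℝ → ℝ} {z : ℝ}

theorem unitRoundoff_pos (F : FPFormat) : 0 < F.unitRoundoff := by
  unfold unitRoundoff; positivity

theorem unitRoundoff_mul_zpow (F : FPFormat) (e : ℤ) :
    F.unitRoundoff * (2 : ℝ) ^ e = (2 : ℝ) ^ (e - (F.prec : ℤ) + 1) / 2 := by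
  have h2 : (2 : ℝ) ≠ 0 := two_ne_zero
  rw [unitRoundoff, ← zpow_add₀ h2, zpow_add_one₀ h2, mul_div_assoc, div_self h2, mul_one]
  congr 1
  ring

theorem two_pow_prec_mul (F : FPFormat) (e : ℤ) :
    (2 : ℝ) ^ F.prec * (2 : ℝ) ^ (e - (F.prec : ℤ) + 1) = (2 : ℝ) ^ (e + 1) := by
  rw [← zpow_natCast, ← zpow_add₀ two_ne_zero]
  congr 1
  ring

theorem neg_mem_numbers (h : z ∈ F.numbers) : -z ∈ F.numbers := by
  obtain ⟨M, e, hM, h1, h2, rfl⟩ := h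
  exact ⟨-M, e, by rwa [abs_neg], h1, h2, by push_cast; ring⟩

theorem two_zpow_mem_numbers (hp : 1 ≤ F.prec) {e : ℤ} (h1 : F.emin ≤ e) (h2 : e ≤ F.emax) :
    (2 : ℝ) ^ e ∈ F.numbers := by
  obtain ⟨n, hn⟩ : ∃ n, F.prec = n + 1 := ⟨F.prec - 1, by omega⟩
  refine ⟨2 ^ n, e, ?_, h1, h2, ?_⟩
  · have : (1 : ℤ) ≤ 2 ^ n := one_le_pow₀ (by norm_num)
    rw [hn, abs_of_pos (by positivity), pow_succ]
    linarith
  · push_cast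
    rw [hn, ← zpow_natCast, ← zpow_add₀ two_ne_zero]
    congr 1
    push_cast
    ring

theorem abs_le_maxFinite (h : z ∈ F.numbers) : |z| ≤ F.maxFinite := by
  obtain ⟨M, e, hM, -, h2, rfl⟩ := h
  have hM' : |(M : ℝ)| ≤ 2 ^ F.prec - 1 := by exact_mod_cast hM
  rw [abs_mul, abs_of_pos (by positivity : (0 : ℝ) < 2 ^ (e - (F.prec : ℤ) + 1))]
  refine mul_le_mul hM' (zpow_le_zpow_right₀ (by norm_num) (by omega)) (by positivity)
    ((abs_nonneg _).trans hM')

theorem maxFinite_lt (F : FPFormat) : F.maxFinite < (2 : ℝ) ^ (F.emax + 1) := by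
  have h := F.two_pow_prec_mul F.emax
  have : (0 : ℝ) < 2 ^ (F.emax - (F.prec : ℤ) + 1) := by positivity
  unfold maxFinite
  rw [sub_mul, h]
  linarith

theorem IsRoundToNearest.eq_self (h : F.IsRoundToNearest RN) (hz : z ∈ F.numbers) : RN z = z := by
  have := (h z).2 z hz
  rw [sub_self, abs_zero] at this
  linarith [abs_nonpos_iff.1 this]

theorem IsRoundToNearest.le_of_le (h : F.IsRoundToNearest RN) {f : ℝ} (hf : f ∈ F.numbers)
    (hfz : f ≤ z) : f ≤ RN z := by
  have := (h z).2 f hf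
  rw [abs_of_nonneg (sub_nonneg.2 hfz)] at this
  linarith [le_abs_self (z - RN z)]

theorem IsRoundToNearest.ge_of_ge (h : F.IsRoundToNearest RN) {f : ℝ} (hf : f ∈ F.numbers)
    (hfz : z ≤ f) : RN z ≤ f := by
  have := (h z).2 f hf
  rw [abs_of_nonpos (sub_nonpos.2 hfz)] at this
  linarith [neg_abs_le (z - RN z)]

/-- A number in the normal domain has an exponent in the range of the format. -/
theorem exists_exponent (h1 : (2 : ℝ) ^ F.emin ≤ |z|) (h2 : |z| ≤ F.maxFinite) :
    ∃ e : ℤ, F.emin ≤ e ∧ e ≤ F.emax ∧ (2 : ℝ) ^ e ≤ |z| ∧ |z| < (2 : ℝ) ^ (e + 1) := by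
  have hz : 0 < |z| := lt_of_lt_of_le (by positivity) h1
  obtain ⟨e, he, he'⟩ := exists_mem_Ico_zpow hz (one_lt_two (α := ℝ))
  refine ⟨e, ?_, ?_, he, he'⟩
  · have := (zpow_lt_zpow_iff_right₀ (one_lt_two (α := ℝ))).1 (h1.trans_lt he')
    omega
  · have := (zpow_lt_zpow_iff_right₀ (one_lt_two (α := ℝ))).1
      ((he.trans h2).trans_lt F.maxFinite_lt)
    omega

/-- Every number of the normal domain is within half a unit in the last place of a floating-point
number. -/
theorem exists_number_near (hp : 1 ≤ F.prec) {e : ℤ} (h1 : F.emin ≤ e) (h2 : e ≤ F.emax)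
    (hz : |z| < (2 : ℝ) ^ (e + 1)) (hmax : |z| ≤ F.maxFinite) :
    ∃ f ∈ F.numbers, |z - f| ≤ F.unitRoundoff * 2 ^ e := by
  rw [F.unitRoundoff_mul_zpow]
  have hh : (0 : ℝ) < 2 ^ (e - (F.prec : ℤ) + 1) := by positivity
  have hpow := F.two_pow_prec_mul e
  set h : ℝ := 2 ^ (e - (F.prec : ℤ) + 1) with hdef
  have hnear : |z - (round (z / h) : ℝ) * h| ≤ h / 2 := by
    have := abs_sub_round (z / h)
    have e1 : z - (round (z / h) : ℝ) * h = (z / h - round (z / h)) * h := by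
      field_simp
    rw [e1, abs_mul, abs_of_pos hh]
    nlinarith
  by_cases hM : |round (z / h)| ≤ 2 ^ F.prec - 1
  · exact ⟨_, ⟨round (z / h), e, hM, h1, h2, rfl⟩, hnear⟩
  -- The integer significand overflows to at least `2 ^ prec`, so `|z|` is within half a spacing of
  -- `2 ^ (e + 1)`, which serves instead. At `e = emax` this would put `|z|` above `maxFinite`.
  · have hM' : (2 : ℤ) ^ F.prec ≤ |round (z / h)| := by omega
    have hMr : (2 : ℝ) ^ F.prec ≤ |(round (z / h) : ℝ)| := by exact_mod_cast hM'
    have habs : |(round (z / h) : ℝ) * h| = |(round (z / h) : ℝ)| * h := by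
      rw [abs_mul, abs_of_pos hh]
    have hle : (2 : ℝ) ^ (e + 1) ≤ |(round (z / h) : ℝ)| * h := by
      rw [← hpow]; gcongr
    have htri : |(round (z / h) : ℝ) * h| - |z| ≤ h / 2 := by
      refine (abs_sub_abs_le_abs_sub _ _).trans ?_
      rwa [abs_sub_comm]
    have hlt : e < F.emax := by
      refine lt_of_le_of_ne h2 fun he => ?_
      have : F.maxFinite = (2 : ℝ) ^ (e + 1) - h := by
        rw [maxFinite, ← he, sub_mul, ← hdef, hpow, one_mul]
      linarith
    have hmem : (2 : ℝ) ^ (e + 1) ∈ F.numbers :=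
      two_zpow_mem_numbers hp (by omega) (by omega)
    have hzlow : (2 : ℝ) ^ (e + 1) - |z| ≤ h / 2 := by linarith
    rcases le_total 0 z with h0 | h0
    · refine ⟨_, hmem, ?_⟩
      rw [abs_of_nonneg h0] at hz hzlow
      rw [abs_of_nonpos (by linarith)]
      linarith
    · refine ⟨_, neg_mem_numbers hmem, ?_⟩
      rw [abs_of_nonpos h0] at hz hzlow
      rw [abs_of_nonneg (by linarith)]
      linarith

theorem IsRoundToNearest.abs_sub_le_of_exponent (h : F.IsRoundToNearest RN) (hp : 1 ≤ F.prec)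
    {e : ℤ} (h1 : F.emin ≤ e) (h2 : e ≤ F.emax) (hz : |z| < (2 : ℝ) ^ (e + 1))
    (hmax : |z| ≤ F.maxFinite) : |RN z - z| ≤ F.unitRoundoff * 2 ^ e := by
  obtain ⟨f, hf, hfz⟩ := exists_number_near hp h1 h2 hz hmax
  rw [abs_sub_comm]
  exact ((h z).2 f hf).trans hfz

/-- The closed endpoint is harmless because a power of two in range is its own rounding. It is
needed for quantities that can equal exactly `1` or `2`. -/
theorem IsRoundToNearest.abs_sub_le (h : F.IsRoundToNearest RN) (hp : 1 ≤ F.prec)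
    (hz : F.NoUnderOverflow z) {k : ℤ} (hk : |z| ≤ (2 : ℝ) ^ (k + 1)) :
    |RN z - z| ≤ F.unitRoundoff * 2 ^ k := by
  have hu := F.unitRoundoff_pos
  rcases hz with hz | ⟨h1, h2⟩
  · rw [h.eq_self hz, sub_self, abs_zero]
    positivity
  · obtain ⟨e, he1, he2, he3, he4⟩ := exists_exponent h1 h2
    rcases (hk.lt_or_eq) with hlt | heq
    · have : e < k + 1 := (zpow_lt_zpow_iff_right₀ (one_lt_two (α := ℝ))).1 (he3.trans_lt hlt)
      refine (h.abs_sub_le_of_exponent hp he1 he2 he4 h2).trans ?_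
      gcongr
      · norm_num
      · omega
    · have hek : e = k + 1 := by
        rw [heq] at he3 he4
        have a := (zpow_le_zpow_iff_right₀ (one_lt_two (α := ℝ))).1 he3
        have b := (zpow_lt_zpow_iff_right₀ (one_lt_two (α := ℝ))).1 he4
        omega
      have hmem : (2 : ℝ) ^ (k + 1) ∈ F.numbers := two_zpow_mem_numbers hp (hek ▸ he1) (hek ▸ he2)
      have hzm : z ∈ F.numbers := by
        rcases abs_choice z with hc | hc
        · rwa [← hc, heq]
        · have := neg_mem_numbers hmem
          rwa [← heq, hc, neg_neg] at this
      rw [h.eq_self hzm, sub_self, abs_zero]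
      positivity

/-- For `2 ^ e ≤ |z| < 2 ^ (e + 1)` the error is at most `u * 2 ^ e`, and also at most the distance
`|z| - 2 ^ e` to a floating-point number. Adding the first bound to `u` times the second eliminates
`2 ^ e`. -/
theorem IsRoundToNearest.abs_sub_le_relative (h : F.IsRoundToNearest RN) (hp : 1 ≤ F.prec)
    (hz : F.NoUnderOverflow z) :
    |RN z - z| ≤ F.unitRoundoff / (1 + F.unitRoundoff) * |z| := by
  have hu := F.unitRoundoff_pos
  rcases hz with hz | ⟨h1, h2⟩
  · rw [h.eq_self hz, sub_self, abs_zero]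
    positivity
  · obtain ⟨e, he1, he2, he3, he4⟩ := exists_exponent h1 h2
    have hA := h.abs_sub_le_of_exponent hp he1 he2 he4 h2
    have hmem : (2 : ℝ) ^ e ∈ F.numbers := two_zpow_mem_numbers hp he1 he2
    have hB : |RN z - z| ≤ |z| - 2 ^ e := by
      rw [abs_sub_comm]
      rcases le_total 0 z with h0 | h0
      · refine ((h z).2 _ hmem).trans_eq ?_
        rw [abs_of_nonneg h0] at he3 ⊢
        rw [abs_of_nonneg (by linarith)]
      · refine ((h z).2 _ (neg_mem_numbers hmem)).trans_eq ?_
        rw [abs_of_nonpos h0] at he3 ⊢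
        rw [abs_of_nonpos (by linarith)]
        ring
    rw [div_mul_eq_mul_div, le_div_iff₀ (by linarith)]
    nlinarith

theorem IsRoundToNearest.two_zpow_le (h : F.IsRoundToNearest RN) (hp : 1 ≤ F.prec)
    (hz : F.NoUnderOverflow z) {k : ℤ} (hk : (2 : ℝ) ^ k ≤ z) : (2 : ℝ) ^ k ≤ RN z := by
  rcases hz with hz | ⟨h1, h2⟩
  · rwa [h.eq_self hz]
  · obtain ⟨e, he1, he2, he3, he4⟩ := exists_exponent h1 h2
    have hz0 : 0 < z := lt_of_lt_of_le (by positivity) hk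
    rw [abs_of_pos hz0] at *
    have hke : k < e + 1 := (zpow_lt_zpow_iff_right₀ (one_lt_two (α := ℝ))).1 (hk.trans_lt he4)
    rcases le_total F.emin k with hm | hm
    · exact h.le_of_le (two_zpow_mem_numbers hp hm (by omega)) hk
    · refine le_trans (zpow_le_zpow_right₀ (by norm_num) hm) ?_
      exact h.le_of_le (two_zpow_mem_numbers hp le_rfl (by omega)) h1

theorem IsRoundToNearest.abs_le_two_zpow (h : F.IsRoundToNearest RN) (hp : 1 ≤ F.prec)
    (hz : F.NoUnderOverflow z) {k : ℤ} (hk : |z| ≤ (2 : ℝ) ^ k) : |RN z| ≤ (2 : ℝ) ^ k := by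
  rcases hz with hz | ⟨h1, h2⟩
  · rwa [h.eq_self hz]
  · have hm : F.emin ≤ k := (zpow_le_zpow_iff_right₀ (one_lt_two (α := ℝ))).1 (h1.trans hk)
    rcases le_or_gt k F.emax with hk' | hk'
    · have hmem : (2 : ℝ) ^ k ∈ F.numbers := two_zpow_mem_numbers hp hm hk'
      rw [abs_le] at hk ⊢
      exact ⟨h.le_of_le (neg_mem_numbers hmem) hk.1, h.ge_of_ge hmem hk.2⟩
    · refine (FPFormat.abs_le_maxFinite (h z).1).trans (F.maxFinite_lt.le.trans ?_)
      exact zpow_le_zpow_right₀ (by norm_num) (by omega)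

/-- A floating-point number of absolute value at least `1` is an integer multiple of `2 u`. -/
theorem exists_eq_mul_of_one_le (hz : z ∈ F.numbers) (h1 : 1 ≤ |z|) :
    ∃ n : ℤ, z = n * (2 * F.unitRoundoff) := by
  obtain ⟨M, e, hM, -, -, rfl⟩ := hz
  have he : 0 ≤ e := by
    have hM' : |(M : ℝ)| ≤ 2 ^ F.prec - 1 := by exact_mod_cast hM
    have hh : (0 : ℝ) < 2 ^ (e - (F.prec : ℤ) + 1) := by positivity
    have hpow := F.two_pow_prec_mul e
    rw [abs_mul, abs_of_pos hh] at h1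
    have : (2 : ℝ) ^ (0 : ℤ) < 2 ^ (e + 1) := by rw [zpow_zero]; nlinarith
    have := (zpow_lt_zpow_iff_right₀ (one_lt_two (α := ℝ))).1 this
    omega
  lift e to ℕ using he
  refine ⟨M * 2 ^ e, ?_⟩
  have := F.unitRoundoff_mul_zpow e
  push_cast
  rw [zpow_natCast] at this
  linear_combination (-2 * (M : ℝ)) * this

end FPFormat

/-! ### The bound `χ₄`: monotonicity and quadratic estimates -/

namespace Beebe

/-- `√((1 + u) (1 + u / 5))` -/
noncomputable def σ (u : ℝ) : ℝ := √((1 + u) * (1 + u / 5))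

/-- The denominator `5 σ(u) / 2 - √5 u` that occurs in `χ₄`. -/
noncomputable def den (u : ℝ) : ℝ := 5 * σ u / 2 - √5 * u

/-- The quotient of `χ₄ u + 1` by the amplification factor of the last rounding. -/
noncomputable def core (u : ℝ) : ℝ :=
  σ u + u ^ 2 * ((1 + 2 * u) / (1 + u) * (√5 / 5 + 1 / den u) + 2 * √5 / (5 * (1 + u)))

theorem sqrt_five_gt : 2.236 < √5 := Real.lt_sqrt_of_sq_lt (by norm_num)

theorem sqrt_five_lt : √5 < 2.23607 := (Real.sqrt_lt' (by norm_num)).2 (by norm_num)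

theorem sqrt_five_mul_self : √5 * √5 = 5 := Real.mul_self_sqrt (by norm_num)

section
variable {u : ℝ}

theorem σ_sq (h : -1 < u) : σ u ^ 2 = (1 + u) * (1 + u / 5) := by
  have h1 : 0 ≤ 1 + u := by linarith
  have h2 : 0 ≤ 1 + u / 5 := by linarith
  exact Real.sq_sqrt (by positivity)

theorem σ_pos (h : -1 < u) : 0 < σ u := by
  have h1 : 0 < 1 + u := by linarith
  have h2 : 0 < 1 + u / 5 := by linarith
  exact Real.sqrt_pos.2 (by positivity)

theorem sqrt_div_eq (h : -1 < u) : √((1 + u / 5) / (1 + u)) = σ u / (1 + u) := by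
  have h1 : 0 < 1 + u := by linarith
  rw [σ, ← Real.sqrt_sq h1.le, ← Real.sqrt_div' _ (by positivity), Real.sqrt_sq h1.le]
  congr 1
  field_simp

/-- This form is a sum of products of positive nondecreasing factors on `[0, 1/16]`, apart from the
constant, which yields monotonicity. -/
theorem χ₄_eq (h : -1 / 2 < u) :
    χ₄ u = (1 + 2 * u) / (1 + u) * σ u - 1 +
      (u ^ 2 * ((1 + 2 * u) / (1 + u)) ^ 2 * (√5 / 5 + 1 / den u) +
        (u / (1 + u)) ^ 2 * (1 + 2 * u) * (2 * √5 / 5)) := by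
  have h1 : 1 + u ≠ 0 := by linarith
  have h2 : 1 + 2 * u ≠ 0 := by linarith
  unfold χ₄
  rw [sqrt_div_eq (by linarith)]
  simp only [den, σ]
  generalize 1 / (5 * √((1 + u) * (1 + u / 5)) / 2 - √5 * u) = E
  field_simp

theorem χ₄_eq_core (h : -1 / 2 < u) : χ₄ u = (1 + 2 * u) / (1 + u) * core u - 1 := by
  have h1 : 1 + u ≠ 0 := by linarith
  have h2 : 1 + 2 * u ≠ 0 := by linarith
  rw [χ₄_eq (by linarith), core]
  generalize 1 / den u = E
  field_simp
  ring

theorem σ_le_linear (h : -1 < u) : σ u ≤ 1 + 3 / 5 * u := by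
  refine Real.sqrt_le_iff.2 ⟨by linarith, ?_⟩
  nlinarith [sq_nonneg u]

theorem σ_le_cubic (h0 : 0 ≤ u) (h1 : u ≤ 1 / 16) :
    σ u ≤ 1 + 3 / 5 * u - 2 / 25 * u ^ 2 + 6 / 125 * u ^ 3 := by
  refine Real.sqrt_le_iff.2 ⟨by nlinarith [pow_nonneg h0 3], ?_⟩
  have : (1 + 3 / 5 * u - 2 / 25 * u ^ 2 + 6 / 125 * u ^ 3) ^ 2 - (1 + u) * (1 + u / 5) =
      u ^ 4 * (8 / 125 - 24 / 3125 * u + 36 / 15625 * u ^ 2) := by ring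
  have : 0 ≤ u ^ 4 * (8 / 125 - 24 / 3125 * u + 36 / 15625 * u ^ 2) := by
    have : 0 ≤ 8 / 125 - 24 / 3125 * u + 36 / 15625 * u ^ 2 := by nlinarith [sq_nonneg u]
    positivity
  linarith

theorem quadratic_le_σ (h0 : 0 ≤ u) (h1 : u ≤ 1 / 16) :
    1 + 3 / 5 * u - 2 / 25 * u ^ 2 ≤ σ u := by
  refine Real.le_sqrt_of_sq_le ?_
  have : (1 + u) * (1 + u / 5) - (1 + 3 / 5 * u - 2 / 25 * u ^ 2) ^ 2 =
      u ^ 3 * (12 / 125 - 4 / 625 * u) := by ring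
  have : 0 ≤ u ^ 3 * (12 / 125 - 4 / 625 * u) := by
    have : 0 ≤ 12 / 125 - 4 / 625 * u := by linarith
    positivity
  linarith

theorem one_le_σ (h0 : 0 ≤ u) : 1 ≤ σ u := by
  refine Real.le_sqrt_of_sq_le ?_
  nlinarith

theorem den_pos (h0 : 0 ≤ u) (h1 : u ≤ 1 / 16) : 0 < den u := by
  have := one_le_σ h0
  have := sqrt_five_lt
  unfold den
  nlinarith

theorem den_le (h0 : 0 ≤ u) : den u ≤ 5 / 2 := by
  have := σ_le_linear (by linarith : -1 < u)
  have := sqrt_five_gt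
  unfold den
  nlinarith

theorem le_one_div_den (h0 : 0 ≤ u) (h1 : u ≤ 1 / 16) : 2 / 5 ≤ 1 / den u := by
  rw [le_div_iff₀ (den_pos h0 h1)]
  linarith [den_le h0]

end

theorem σ_mono {a b : ℝ} (ha : 0 ≤ a) (hab : a ≤ b) : σ a ≤ σ b :=
  Real.sqrt_le_sqrt (by nlinarith)

theorem den_anti {a b : ℝ} (ha : 0 ≤ a) (hab : a ≤ b) (hb : b ≤ 1 / 16) : den b ≤ den a := by
  have h1 := one_le_σ ha
  have h2 := σ_mono ha hab
  have h3 := σ_sq (by linarith : -1 < a)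
  have h4 := σ_sq (by linarith : -1 < b)
  -- Any Lipschitz constant for `σ` below `2√5/5 ≈ 0.89` makes `den` antitone.
  have h5 : σ b - σ a ≤ 7 / 10 * (b - a) := by
    have : (σ b - σ a) * (σ b + σ a) = (b - a) * (6 / 5 + (a + b) / 5) := by linarith
    nlinarith
  have := sqrt_five_gt
  unfold den
  nlinarith

theorem strictMonoOn_χ₄ : StrictMonoOn χ₄ (Set.Icc (0 : ℝ) (1 / 16)) := by
  rintro a ⟨ha0, ha1⟩ b ⟨hb0, hb1⟩ hab
  have hk : ∀ v : ℝ, 0 ≤ v → (1 + 2 * v) / (1 + v) = 2 - 1 / (1 + v) := by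
    intro v hv
    field_simp
    ring
  have hκ : (1 + 2 * a) / (1 + a) < (1 + 2 * b) / (1 + b) := by
    rw [hk a ha0, hk b hb0]
    have : 1 / (1 + b) < 1 / (1 + a) := one_div_lt_one_div_of_lt (by linarith) (by linarith)
    linarith
  have hκ0 : 0 < (1 + 2 * a) / (1 + a) := by positivity
  have hσ := σ_mono ha0 hab.le
  have hσ0 : 0 < σ a := σ_pos (by linarith)
  have hq : a / (1 + a) ≤ b / (1 + b) := by
    rw [div_le_div_iff₀ (by linarith) (by linarith)]
    linarith
  have hD : 1 / den a ≤ 1 / den b :=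
    one_div_le_one_div_of_le (den_pos hb0 hb1) (den_anti ha0 hab.le hb1)
  have hD0 : 0 < 1 / den a := one_div_pos.2 (den_pos ha0 ha1)
  rw [χ₄_eq (by linarith), χ₄_eq (by linarith)]
  have t1 : (1 + 2 * a) / (1 + a) * σ a < (1 + 2 * b) / (1 + b) * σ b :=
    mul_lt_mul hκ hσ hσ0 (hκ0.trans hκ).le
  have t2 : a ^ 2 * ((1 + 2 * a) / (1 + a)) ^ 2 * (√5 / 5 + 1 / den a) ≤
      b ^ 2 * ((1 + 2 * b) / (1 + b)) ^ 2 * (√5 / 5 + 1 / den b) := by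
    gcongr
  have t3 : (a / (1 + a)) ^ 2 * (1 + 2 * a) * (2 * √5 / 5) ≤
      (b / (1 + b)) ^ 2 * (1 + 2 * b) * (2 * √5 / 5) := by
    gcongr
  linarith

/-- A deliberately weak bound (the true quadratic coefficient is about `1.26`), sufficient for the
error from below. -/
theorem le_χ₄ {u : ℝ} (h0 : 0 ≤ u) (h1 : u ≤ 1 / 16) : 8 / 5 * u + u ^ 2 ≤ χ₄ u := by
  have hσ := quadratic_le_σ h0 h1
  have hD := le_one_div_den h0 h1
  have h5 := sqrt_five_gt
  rw [χ₄_eq_core (by linarith), core]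
  have hκ : 1 ≤ (1 + 2 * u) / (1 + u) := by
    rw [le_div_iff₀ (by linarith)]
    linarith
  have hc : 4 / 5 ≤ 2 * √5 / (5 * (1 + u)) := by
    rw [le_div_iff₀ (by linarith)]
    nlinarith
  have hb : 4 / 5 ≤ (1 + 2 * u) / (1 + u) * (√5 / 5 + 1 / den u) := by
    nlinarith
  have hcore : 1 + 3 / 5 * u - 2 / 25 * u ^ 2 + u ^ 2 * (8 / 5) ≤
      σ u + u ^ 2 * ((1 + 2 * u) / (1 + u) * (√5 / 5 + 1 / den u) + 2 * √5 / (5 * (1 + u))) := by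
    have : u ^ 2 * (8 / 5) ≤
        u ^ 2 * ((1 + 2 * u) / (1 + u) * (√5 / 5 + 1 / den u) + 2 * √5 / (5 * (1 + u))) := by
      gcongr
      linarith
    linarith
  have hmul := mul_le_mul_of_nonneg_left hcore (by linarith : 0 ≤ (1 + 2 * u) / (1 + u))
  have : 8 / 5 * u + u ^ 2 + 1 ≤
      (1 + 2 * u) / (1 + u) * (1 + 3 / 5 * u - 2 / 25 * u ^ 2 + u ^ 2 * (8 / 5)) := by
    rw [div_mul_eq_mul_div (1 + 2 * u), le_div_iff₀ (by linarith)]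
    nlinarith [pow_nonneg h0 3, sq_nonneg u]
  linarith

theorem χ₄_le {u : ℝ} (h0 : 0 ≤ u) (h1 : u ≤ 1 / 16) : χ₄ u ≤ 8 / 5 * u + 7 / 5 * u ^ 2 := by
  have hσ := σ_le_cubic h0 h1
  have hσ' := quadratic_le_σ h0 h1
  have h5 := sqrt_five_lt
  -- The quadratic and cubic coefficients of `χ₄` are about `1.262` and `2.18`, and `1.262 +
  -- 2.18/16` is just below `7/5`; hence the precise decimals. Here `0.73608` exceeds `√5 - 3/2`,
  -- and below `0.123` exceeds the slope `(4/25)(√5 - 3/2)` of `1 / den` at `0`.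
  have hD : 1 / den u ≤ 1 / (5 / 2 - 0.73608 * u - u ^ 2 / 5) := by
    have : 0 < 5 / 2 - 0.73608 * u - u ^ 2 / 5 := by nlinarith
    refine one_div_le_one_div_of_le this ?_
    unfold den
    nlinarith
  have hE : 1 / (5 / 2 - 0.73608 * u - u ^ 2 / 5) ≤ 2 / 5 + 0.123 * u := by
    have : 0 < 5 / 2 - 0.73608 * u - u ^ 2 / 5 := by nlinarith
    rw [div_le_iff₀ this]
    nlinarith [pow_nonneg h0 3, sq_nonneg u]
  have hκ : 0 ≤ (1 + 2 * u) / (1 + u) := by positivity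
  have hc : 2 * √5 / (5 * (1 + u)) ≤ 0.894428 / (1 + u) := by
    rw [div_le_div_iff₀ (by linarith) (by linarith)]
    nlinarith
  rw [χ₄_eq_core (by linarith)]
  have hcore : core u ≤ 1 + 3 / 5 * u - 2 / 25 * u ^ 2 + 6 / 125 * u ^ 3 +
      u ^ 2 * ((1 + 2 * u) / (1 + u) * (0.847214 + 0.123 * u) + 0.894428 / (1 + u)) := by
    have : √5 / 5 + 1 / den u ≤ 0.847214 + 0.123 * u := by linarith
    unfold core
    gcongr
  have : (1 + 2 * u) / (1 + u) * (1 + 3 / 5 * u - 2 / 25 * u ^ 2 + 6 / 125 * u ^ 3 +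
      u ^ 2 * ((1 + 2 * u) / (1 + u) * (0.847214 + 0.123 * u) + 0.894428 / (1 + u))) ≤
      8 / 5 * u + 7 / 5 * u ^ 2 + 1 := by
    have hpos : 0 < 1 + u := by linarith
    have e : (1 + 2 * u) / (1 + u) * (1 + 3 / 5 * u - 2 / 25 * u ^ 2 + 6 / 125 * u ^ 3 +
      u ^ 2 * ((1 + 2 * u) / (1 + u) * (0.847214 + 0.123 * u) + 0.894428 / (1 + u))) =
      (1 + 2 * u) * ((1 + 3 / 5 * u - 2 / 25 * u ^ 2 + 6 / 125 * u ^ 3) * (1 + u) +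
      u ^ 2 * ((1 + 2 * u) * (0.847214 + 0.123 * u) + 0.894428)) / (1 + u) ^ 2 := by
      field_simp
    rw [e, div_le_iff₀ (by positivity)]
    have key : 0 ≤ u ^ 2 * (1 / 16 - u) := mul_nonneg (sq_nonneg u) (by linarith)
    nlinarith [pow_nonneg h0 3, pow_nonneg h0 4, pow_nonneg h0 5, mul_nonneg key h0, sq_nonneg u,
      mul_nonneg key (pow_nonneg h0 2)]
  have := mul_le_mul_of_nonneg_left hcore hκ
  linarith

end Beebe

/-! ### Taylor expansion of `χ₄` at the origin, with exact remainders -/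

namespace Beebe

theorem continuousAt_σ_zero : ContinuousAt σ 0 := by
  unfold σ
  fun_prop

theorem σ_zero : σ 0 = 1 := by simp [σ]

theorem continuousAt_den_zero : ContinuousAt den 0 := by
  have := continuousAt_σ_zero
  unfold den
  fun_prop

theorem den_zero : den 0 = 5 / 2 := by simp [den, σ_zero]

/-- The cubic Taylor polynomial of `σ` at the origin. -/
noncomputable def σTaylor (u : ℝ) : ℝ := 1 + 3 / 5 * u - 2 / 25 * u ^ 2 + 6 / 125 * u ^ 3

/-- The quotient of the remainder of the cubic Taylor expansion of `σ` by `u ^ 4`. -/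
noncomputable def σRem (u : ℝ) : ℝ :=
  -(8 / 125 - 24 / 3125 * u + 36 / 15625 * u ^ 2) / (σ u + σTaylor u)

/-- The quotient of the remainder of the linear Taylor expansion of `1 / den` by `u ^ 2`. -/
noncomputable def denInvRem (u : ℝ) : ℝ :=
  ((6 / 25 - 4 * √5 / 25) * (3 / 2 - √5) -
    (1 - 5 / 2 * (6 / 25 - 4 * √5 / 25) * u) * (-2 / 25 + 6 / 125 * u + u ^ 2 * σRem u)) / den u

theorem continuousAt_σRem_zero : ContinuousAt σRem 0 := by
  have := continuousAt_σ_zero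
  unfold σRem σTaylor
  refine ContinuousAt.div (by fun_prop) (by fun_prop) ?_
  norm_num [σ_zero]

theorem continuousAt_denInvRem_zero : ContinuousAt denInvRem 0 := by
  have := continuousAt_σRem_zero
  have := continuousAt_den_zero
  unfold denInvRem
  refine ContinuousAt.div (by fun_prop) (by fun_prop) ?_
  norm_num [den_zero]

/-- Since `σ² - σTaylor²` is a polynomial divisible by `u⁴`, dividing by `σ + σTaylor`, which is `2`
at the origin, gives an exact remainder. -/
theorem σ_eq_taylor {u : ℝ} (h : -1 < u) (h' : σ u + σTaylor u ≠ 0) :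
    σ u = σTaylor u + u ^ 4 * σRem u := by
  have h2 := σ_sq h
  unfold σRem
  rw [← mul_div_assoc, ← sub_eq_iff_eq_add', eq_div_iff h']
  unfold σTaylor
  linear_combination h2

theorem one_div_den_eq_taylor {u : ℝ} (h : -1 < u) (h' : σ u + σTaylor u ≠ 0) (hd : den u ≠ 0) :
    1 / den u = 2 / 5 - (6 / 25 - 4 * √5 / 25) * u + u ^ 2 * denInvRem u := by
  unfold denInvRem
  rw [← mul_div_assoc, ← sub_eq_iff_eq_add', div_sub' hd]
  congr 1
  have h2 := σ_eq_taylor h h'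
  unfold σTaylor at h2
  unfold den
  linear_combination (-5 / 2 * (2 / 5 - (6 / 25 - 4 * √5 / 25) * u)) * h2

theorem χ₄_taylor :
    (fun u : ℝ => χ₄ u - (8 / 5 * u + (3 * √5 / 5 - 2 / 25) * u ^ 2 +
        (116 / 125 + 14 * √5 / 25) * u ^ 3)) =O[𝓝 0] (fun u : ℝ => u ^ 4) := by
  have hσR := continuousAt_σRem_zero
  have hdR := continuousAt_denInvRem_zero
  -- `G` is the exact quotient of the remainder by `u ^ 4`; its continuity at `0` makes it bounded
  -- there. A linear expansion of `1 / den` suffices because that term carries a factor `u ^ 2`.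
  let G : ℝ → ℝ := fun u => (1 + 2 * u) / (1 + u) * σRem u +
    ((1 + 2 * u) / (1 + u)) ^ 2 * denInvRem u + 
    (-144 / 125 - 7 * √5 / 25 + (-224 / 125 + 2 * √5 / 25) * u) / (1 + u) ^ 2
  have hG : ContinuousAt G 0 := by
    have h1 : (1 : ℝ) + 0 ≠ 0 := by norm_num
    have h2 : ((1 : ℝ) + 0) ^ 2 ≠ 0 := by norm_num
    fun_prop (disch := assumption)
  have e1 : ∀ᶠ u : ℝ in 𝓝 0, -1 / 2 < u := lt_mem_nhds (by norm_num)
  have e2 : ∀ᶠ u : ℝ in 𝓝 0, den u ≠ 0 :=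
    continuousAt_den_zero.eventually_ne (by norm_num [den_zero])
  have e3 : ∀ᶠ u : ℝ in 𝓝 0, σ u + σTaylor u ≠ 0 := by
    refine ContinuousAt.eventually_ne ?_ (by norm_num [σ_zero, σTaylor])
    have := continuousAt_σ_zero
    unfold σTaylor
    fun_prop
  have key : (fun u : ℝ => χ₄ u - (8 / 5 * u + (3 * √5 / 5 - 2 / 25) * u ^ 2 +
        (116 / 125 + 14 * √5 / 25) * u ^ 3)) =ᶠ[𝓝 0] fun u => u ^ 4 * G u := by
    filter_upwards [e1, e2, e3] with u h1 h2 h3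
    have hu : 1 + u ≠ 0 := by linarith
    rw [χ₄_eq h1, σ_eq_taylor (by linarith) h3, one_div_den_eq_taylor (by linarith) h3 h2]
    simp only [G, σTaylor]
    field_simp
    ring
  refine key.trans_isBigO ?_
  simpa using (isBigO_refl (fun u : ℝ => u ^ 4) (𝓝 0)).mul (hG.isBigO_one ℝ)

end Beebe

/-! ### Real inequalities behind the error analysis -/

namespace Beebe

section real

variable {u q s τ : ℝ}

/-- The relative change of `1 + q ^ 2` caused by rounding `q` and `1 + q ^ 2`, in the range
`1 / 2 ≤ q`. -/
theorem perturbation_le_of_half_le (hu : 0 ≤ u) (hq : 1 / 2 ≤ q) :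
    u + q * u + u ^ 2 / 4 ≤ (6 * u + u ^ 2) / 5 * (1 + q ^ 2) := by
  -- Five times the difference of the two sides; it vanishes at `q = 1 / 2`.
  have : 0 ≤ u * ((2 * q - 1) * (3 * q - 1) + u * (q - 1 / 2) * (q + 1 / 2)) := by
    have h1 : 0 ≤ 2 * q - 1 := by linarith
    have h2 : 0 ≤ 3 * q - 1 := by linarith
    have h3 : 0 ≤ q - 1 / 2 := by linarith
    have h4 : 0 ≤ q + 1 / 2 := by linarith
    positivity
  linarith

/-- The constant `53/50` is just above `(2 + √5)/4`, the maximum of `(1 + q/2)/(1 + q²)`. -/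
theorem perturbation_le_of_lt_half (hu : 0 ≤ u) :
    u + q * u / 2 + u ^ 2 / 16 ≤ (53 / 50 * u + u ^ 2 / 16) * (1 + q ^ 2) := by
  have : 0 ≤ 53 / 50 * q ^ 2 - q / 2 + 3 / 50 := by nlinarith [sq_nonneg (q - 1 / 4)]
  nlinarith [mul_nonneg hu this, mul_nonneg (sq_nonneg u) (sq_nonneg q)]

/-- With `s` replaced by its lower bound `τ - u`, the left side increases with `τ`, so `τ` may be
replaced by `σ u * v`. The second-order terms relative to `v` are then largest at `v = √5 / 2`, that
is `|q| = 1/2`, and this produces `den`. -/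
theorem core_bound_of_half_le (hu0 : 0 ≤ u) (hu1 : u ≤ 1 / 16) {v : ℝ} (hv : √5 / 2 ≤ v)
    (hτ1 : 1 ≤ τ) (hτ : τ ≤ σ u * v) (hs : τ - u ≤ s) :
    τ + (1 + 2 * u) / (1 + u) * (u ^ 2 / (2 * s) + u ^ 2 / 2) + u ^ 2 / (1 + u) ≤ core u * v := by
  have h5 := sqrt_five_gt
  have h55 := sqrt_five_mul_self
  have hσ := one_le_σ hu0
  have hD := den_pos hu0 hu1
  set κ := (1 + 2 * u) / (1 + u) with hκ
  have hκ0 : 0 ≤ κ := by positivity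
  have hκ2 : κ ≤ 2 := by
    rw [hκ, div_le_iff₀ (by linarith)]
    linarith
  have hv0 : 0 < v := by linarith
  set T := σ u * v with hT
  have hb : 0 < τ - u := by linarith
  have hB : 0 < T - u := by linarith
  have hstep : τ + κ * (u ^ 2 / (2 * (τ - u))) ≤ T + κ * (u ^ 2 / (2 * (T - u))) := by
    have e : T + κ * (u ^ 2 / (2 * (T - u))) - (τ + κ * (u ^ 2 / (2 * (τ - u)))) =
        (T - τ) * (2 * ((τ - u) * (T - u)) - κ * u ^ 2) / (2 * ((τ - u) * (T - u))) := by
      field_simp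
      ring
    have : 0 ≤ (T - τ) * (2 * ((τ - u) * (T - u)) - κ * u ^ 2) / (2 * ((τ - u) * (T - u))) := by
      refine div_nonneg (mul_nonneg (by linarith) ?_) (by positivity)
      have : 3 / 4 * (3 / 4) ≤ (τ - u) * (T - u) :=
        mul_le_mul (by linarith) (by linarith) (by norm_num) hb.le
      have : κ * u ^ 2 ≤ 2 * (1 / 16) ^ 2 := by gcongr
      linarith
    linarith
  have hs' : u ^ 2 / (2 * s) ≤ u ^ 2 / (2 * (τ - u)) := by gcongr
  have hden : u ^ 2 / (2 * (T - u)) ≤ u ^ 2 * (1 / den u) * v := by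
    have : den u ≤ 2 * (T - u) * v := by
      have h1 : √5 / 2 * (σ u * (√5 / 2) - u) ≤ v * (σ u * v - u) := by
        refine mul_le_mul hv (by gcongr) ?_ hv0.le
        nlinarith
      have h2 : √5 / 2 * (σ u * (√5 / 2) - u) = den u / 2 := by
        unfold den
        linear_combination (σ u / 4) * h55
      rw [hT]
      linarith
    rw [mul_one_div, div_mul_eq_mul_div, div_le_div_iff₀ (by positivity) hD]
    nlinarith [mul_le_mul_of_nonneg_left this (sq_nonneg u)]
  have hone : 1 ≤ 2 * √5 / 5 * v := by nlinarith
  have h2 : u ^ 2 / 2 ≤ u ^ 2 * (√5 / 5) * v := by nlinarith [sq_nonneg u]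
  have h3 : u ^ 2 / (1 + u) ≤ u ^ 2 * (2 * √5 / (5 * (1 + u))) * v := by
    have e : u ^ 2 * (2 * √5 / (5 * (1 + u))) * v = u ^ 2 / (1 + u) * (2 * √5 / 5 * v) := by
      field_simp
    rw [e]
    exact le_mul_of_one_le_right (by positivity) hone
  have hcore : core u * v = T + κ * (u ^ 2 * (√5 / 5) * v) + κ * (u ^ 2 * (1 / den u) * v) +
      u ^ 2 * (2 * √5 / (5 * (1 + u))) * v := by
    rw [core, hT]
    ring
  have m1 := mul_le_mul_of_nonneg_left hs' hκ0
  have m2 := mul_le_mul_of_nonneg_left hden hκ0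
  have m3 := mul_le_mul_of_nonneg_left h2 hκ0
  rw [hcore, mul_add]
  linarith

/-- The linear coefficient is `53/100` against `3/5` in `σ`; for `u ≤ 1/16` this gap absorbs the
second-order terms, although `v` may be as small as `1`. -/
theorem core_bound_of_lt_half (hu0 : 0 ≤ u) (hu1 : u ≤ 1 / 16) {v : ℝ} (hv : 1 ≤ v)
    (hτ : τ ≤ √(1 + (53 / 50 * u + u ^ 2 / 16)) * v) (hs : 1 ≤ s) :
    τ + (1 + 2 * u) / (1 + u) * (u ^ 2 / (2 * s) + u ^ 2 / 2) + u ^ 2 / (1 + u) ≤ core u * v := by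
  have h5 := sqrt_five_gt
  have hσ := quadratic_le_σ hu0 hu1
  have hD := le_one_div_den hu0 hu1
  set κ := (1 + 2 * u) / (1 + u) with hκ
  have hκ0 : 0 ≤ κ := by positivity
  have hκ2 : κ ≤ 2 := by
    rw [hκ, div_le_iff₀ (by linarith)]
    linarith
  have hR : √(1 + (53 / 50 * u + u ^ 2 / 16)) ≤ 1 + 53 / 100 * u + u ^ 2 / 32 := by
    refine Real.sqrt_le_iff.2 ⟨by positivity, ?_⟩
    nlinarith [sq_nonneg (53 / 100 * u + u ^ 2 / 32)]
  have hi : 0 ≤ u ^ 2 / (1 + u) := by positivity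
  have hi1 : u ^ 2 / (1 + u) ≤ u ^ 2 := div_le_self (sq_nonneg u) (by linarith)
  have hsq : u ^ 2 ≤ u / 16 := by nlinarith
  have hs' : u ^ 2 / (2 * s) ≤ u ^ 2 / 2 := by
    gcongr
    linarith
  have hcore : 1 + 53 / 100 * u + u ^ 2 / 32 + κ * u ^ 2 + u ^ 2 / (1 + u) ≤ core u := by
    have e : core u = σ u + κ * u ^ 2 * (√5 / 5 + 1 / den u) + u ^ 2 / (1 + u) * (2 * √5 / 5) := by
      rw [core, hκ]
      have : 1 + u ≠ 0 := by linarith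
      generalize 1 / den u = E
      field_simp
      ring
    have hk0 : 0 ≤ κ * u ^ 2 := by positivity
    have hk1 : κ * u ^ 2 ≤ 2 * u ^ 2 := by gcongr
    have a1 : κ * u ^ 2 * (4 / 5) ≤ κ * u ^ 2 * (√5 / 5 + 1 / den u) := by
      gcongr
      linarith
    have a2 : u ^ 2 / (1 + u) * (4 / 5) ≤ u ^ 2 / (1 + u) * (2 * √5 / 5) := by
      gcongr
      linarith
    rw [e]
    linarith
  have m1 := mul_le_mul_of_nonneg_left hs' hκ0
  have hsum : τ + κ * (u ^ 2 / (2 * s) + u ^ 2 / 2) + u ^ 2 / (1 + u) ≤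
      (1 + 53 / 100 * u + u ^ 2 / 32) * v + κ * u ^ 2 + u ^ 2 / (1 + u) := by
    have := mul_le_mul_of_nonneg_right hR (by linarith : 0 ≤ v)
    rw [mul_add]
    linarith
  have hk : κ * u ^ 2 ≤ κ * u ^ 2 * v := le_mul_of_one_le_right (by positivity) hv
  have hk' : u ^ 2 / (1 + u) ≤ u ^ 2 / (1 + u) * v := le_mul_of_one_le_right hi hv
  have := mul_le_mul_of_nonneg_right hcore (by linarith : 0 ≤ v)
  linarith

theorem one_sub_le_sqrt {a : ℝ} (h0 : 0 ≤ a) (h1 : a ≤ 1) :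
    1 - a / 2 - a ^ 2 / 2 ≤ √(1 - a) := by
  refine Real.le_sqrt_of_sq_le ?_
  have : 0 ≤ a ^ 2 * (1 - a) * (3 + a) := by
    have : 0 ≤ 1 - a := by linarith
    positivity
  nlinarith

/-- Both sides agree to first order, `1 - 3u/5`. The term `3u²/2` is `u²/2` for the rounding of `c`
plus `u²` for that of `ν`. -/
theorem one_sub_χ₄_le (hu0 : 0 ≤ u) (hu1 : u ≤ 1 / 16) :
    (1 - χ₄ u) * (1 + u) ≤ √(1 - (6 * u + u ^ 2) / 5) - 3 / 2 * u ^ 2 := by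
  have h1 := le_χ₄ hu0 hu1
  have h2 := one_sub_le_sqrt (a := (6 * u + u ^ 2) / 5) (by positivity) (by nlinarith)
  refine le_trans ?_ (sub_le_sub_right h2 _)
  have h3 := mul_le_mul_of_nonneg_right h1 (by linarith : 0 ≤ 1 + u)
  have : 0 ≤ u ^ 2 * (1 / 16 - u) := mul_nonneg (sq_nonneg u) (by linarith)
  nlinarith [pow_nonneg hu0 3, mul_nonneg this hu0]

end real

/-! ### Error analysis of the algorithm -/

section steps

variable {F : FPFormat} {RN : ℝ → ℝ} {x y : ℝ}

theorem prec_pos (hF : F.unitRoundoff ≤ 1 / 16) : 1 ≤ F.prec := by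
  by_contra h
  have : F.prec = 0 := by omega
  norm_num [FPFormat.unitRoundoff, this] at hF

/-- The residual of a rounded square root is a floating-point number. -/
theorem sqrt_residual_exact (hF : F.unitRoundoff ≤ 1 / 16) (hRN : F.IsRoundToNearest RN) {t s : ℝ}
    (ht : t ∈ F.numbers) (hs : s ∈ F.numbers) (ht1 : 1 ≤ t) (ht2 : t ≤ 2) (hs1 : 1 ≤ s)
    (hst : |s - √t| ≤ F.unitRoundoff) (hsafe : F.NoUnderOverflow (t - s ^ 2)) :
    RN (t - s ^ 2) = t - s ^ 2 := by
  refine hRN.eq_self (hsafe.elim id fun hn => ?_)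
  have h1 := hn.1
  have hu := F.unitRoundoff_pos
  set u := F.unitRoundoff with hudef
  obtain ⟨a, ha⟩ := FPFormat.exists_eq_mul_of_one_le ht (by rwa [abs_of_pos (by linarith)])
  obtain ⟨b, hb⟩ := FPFormat.exists_eq_mul_of_one_le hs (by rwa [abs_of_pos (by linarith)])
  rw [← hudef] at ha hb
  have hup : u * (2 : ℝ) ^ F.prec = 1 := by
    rw [hudef, FPFormat.unitRoundoff, ← zpow_natCast, ← zpow_add₀ two_ne_zero]
    simp
  have hsqrt : √t ≤ 1.42 := Real.sqrt_le_iff.2 ⟨by norm_num, by norm_num; linarith⟩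
  have hsq := Real.sq_sqrt (by linarith : 0 ≤ t)
  have hs2 := (abs_le.1 hst)
  have hbound : |t - s ^ 2| ≤ 3 * u := by
    have : t - s ^ 2 = -((s - √t) * (s + √t)) := by linear_combination -hsq
    rw [this, abs_neg, abs_mul, abs_of_pos (by positivity : 0 < s + √t)]
    calc |s - √t| * (s + √t) ≤ u * 3 := by
          refine mul_le_mul hst (by linarith) (by positivity) hu.le
      _ = 3 * u := by ring
  have hp := prec_pos hF
  obtain ⟨n, hn⟩ : ∃ n, F.prec = n + 1 := ⟨F.prec - 1, by omega⟩
  have hun : u * (2 : ℝ) ^ n = 1 / 2 := by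
    rw [hn, pow_succ] at hup
    linarith
  -- Both `t` and `s` are multiples of `2u`, so the residual is a multiple of `4u²`. Being at most
  -- `3u` in absolute value, it has a significand below `2 ^ prec` at exponent `1 - prec`.
  have hval : t - s ^ 2 = ((a * 2 ^ n - b ^ 2 : ℤ) : ℝ) * (4 * u ^ 2) := by
    push_cast
    rw [ha, hb]
    linear_combination (-4 * a * u) * hun
  have hpow : (2 : ℝ) ^ ((1 - F.prec : ℤ) - (F.prec : ℤ) + 1) = 4 * u ^ 2 := by
    have := F.unitRoundoff_mul_zpow (1 - F.prec)
    rw [← hudef, zpow_sub₀ two_ne_zero, zpow_natCast, zpow_one] at this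
    have hp0 : (2 : ℝ) ^ F.prec ≠ 0 := by positivity
    have h2 : (2 : ℝ) / 2 ^ F.prec = 2 * u := by
      rw [div_eq_iff hp0]
      linear_combination -2 * hup
    rw [h2] at this
    linarith
  refine ⟨a * 2 ^ n - b ^ 2, 1 - F.prec, ?_, ?_, ?_, by rw [hpow, hval]⟩
  · rw [hval, abs_mul, abs_of_pos (by positivity : 0 < 4 * u ^ 2)] at hbound
    have : |((a * 2 ^ n - b ^ 2 : ℤ) : ℝ)| < 2 ^ F.prec := by
      have hlt : |((a * 2 ^ n - b ^ 2 : ℤ) : ℝ)| * u < 1 := by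
        by_contra hc
        push Not at hc
        nlinarith
      by_contra hc
      push Not at hc
      nlinarith
    have : |a * 2 ^ n - b ^ 2| < 2 ^ F.prec := by exact_mod_cast this
    omega
  -- The absence of underflow gives `2 ^ emin ≤ 3u < 4u`, so the exponent `1 - prec` is admissible.
  · have : (2 : ℝ) ^ F.emin < 2 ^ (2 - F.prec : ℤ) := by
      refine lt_of_le_of_lt (h1.trans hbound) ?_
      rw [sub_eq_add_neg, zpow_add₀ two_ne_zero, ← FPFormat.unitRoundoff, ← hudef]
      norm_num
      linarith
    have := (zpow_lt_zpow_iff_right₀ (one_lt_two (α := ℝ))).1 this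
    omega
  · have hle := FPFormat.abs_le_maxFinite ht
    rw [abs_of_pos (by linarith)] at hle
    have : (2 : ℝ) ^ (0 : ℤ) < 2 ^ (F.emax + 1) := by
      rw [zpow_zero]
      exact lt_of_le_of_lt (ht1.trans hle) F.maxFinite_lt
    have := (zpow_lt_zpow_iff_right₀ (one_lt_two (α := ℝ))).1 this
    omega

/-- Rounding a number that exceeds `u` by little is as accurate as rounding a number below `u`. -/
theorem abs_round_sub_le_half_sq (hF : F.unitRoundoff ≤ 1 / 16) (hRN : F.IsRoundToNearest RN)
    {z : ℝ} (hz : F.NoUnderOverflow z) (h1 : -F.unitRoundoff ≤ z)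
    (h2 : z ≤ F.unitRoundoff + F.unitRoundoff ^ 2 / 2) :
    |RN z - z| ≤ F.unitRoundoff ^ 2 / 2 := by
  have hp := prec_pos hF
  have hu := F.unitRoundoff_pos
  have hu2 : F.unitRoundoff = (2 : ℝ) ^ (-(F.prec : ℤ)) := rfl
  rcases le_or_gt z F.unitRoundoff with h | h
  · have := hRN.abs_sub_le hp hz (k := -F.prec - 1)
      (by rw [sub_add_cancel, ← hu2]; exact abs_le.2 ⟨h1, h⟩)
    rw [zpow_sub_one₀ two_ne_zero, ← hu2] at this
    linarith
  · have hz0 : 0 < z := hu.trans h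
    rcases hz with hz | ⟨hz1, hz2⟩
    · rw [hRN.eq_self hz, sub_self, abs_zero]
      positivity
    · obtain ⟨e, he1, he2, he3, he4⟩ := FPFormat.exists_exponent hz1 hz2
      rw [abs_of_pos hz0] at he3 he4
      have a1 : (2 : ℝ) ^ (-(F.prec : ℤ)) < 2 ^ (e + 1) := by
        rw [← hu2]
        linarith
      have a2 : (2 : ℝ) ^ e < 2 ^ (-(F.prec : ℤ) + 1) := by
        rw [zpow_add_one₀ two_ne_zero, ← hu2]
        nlinarith
      have b1 := (zpow_lt_zpow_iff_right₀ (one_lt_two (α := ℝ))).1 a1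
      have b2 := (zpow_lt_zpow_iff_right₀ (one_lt_two (α := ℝ))).1 a2
      -- The number `u` is itself representable, and lies within `u²/2` of `z`.
      have hmem : F.unitRoundoff ∈ F.numbers := by
        rw [hu2]
        exact FPFormat.two_zpow_mem_numbers hp (by omega) (by omega)
      have := (hRN z).2 _ hmem
      rw [abs_sub_comm, abs_of_pos (sub_pos.2 h)] at this
      linarith

/-- The bounds on the intermediate quantities `r` and `t`. -/
theorem r_t_bounds (hp : 1 ≤ F.prec) (hRN : F.IsRoundToNearest RN) (hyx : |y / x| ≤ 1)
    (hsafe : StepsSafe F RN x y) : |r RN x y| ≤ 1 ∧ 1 ≤ t RN x y ∧ t RN x y ≤ 2 ∧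
      |t RN x y - (1 + r RN x y ^ 2)| ≤ F.unitRoundoff := by
  obtain ⟨h1, h2, -⟩ := hsafe
  have hr : |r RN x y| ≤ 1 := by
    simpa [r] using hRN.abs_le_two_zpow hp h1 (k := 0) (by simpa using hyx)
  have hr2 : r RN x y ^ 2 ≤ 1 := by
    rw [← sq_abs]
    exact pow_le_one₀ (abs_nonneg _) hr
  have habs : |1 + r RN x y ^ 2| ≤ 2 := by
    rw [abs_of_pos (by positivity)]
    linarith
  refine ⟨hr, ?_, ?_, ?_⟩
  · simpa [t] using hRN.two_zpow_le hp h2 (k := 0) (by simpa using sq_nonneg _)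
  · refine (le_abs_self _).trans ?_
    simpa [t] using hRN.abs_le_two_zpow hp h2 (k := 1) (by simpa using habs)
  · simpa [t] using hRN.abs_sub_le hp h2 (k := 0) (by simpa using habs)

theorem s_bounds (hp : 1 ≤ F.prec) (hRN : F.IsRoundToNearest RN) (hyx : |y / x| ≤ 1)
    (hsafe : StepsSafe F RN x y) :
    1 ≤ s RN x y ∧ |s RN x y - √(t RN x y)| ≤ F.unitRoundoff := by
  obtain ⟨-, ht1, ht2, -⟩ := r_t_bounds hp hRN hyx hsafe
  obtain ⟨-, -, h3, -⟩ := hsafe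
  have h1 : 1 ≤ √(t RN x y) := Real.one_le_sqrt.2 ht1
  have h2 : √(t RN x y) ≤ 2 := Real.sqrt_le_iff.2 ⟨by norm_num, by linarith⟩
  refine ⟨?_, ?_⟩
  · simpa [s] using hRN.two_zpow_le hp h3 (k := 0) (by simpa using h1)
  · simpa [s] using hRN.abs_sub_le hp h3 (k := 0)
      (by simpa [abs_of_nonneg (Real.sqrt_nonneg _)] using h2)

/-- The rounding error of `t` with respect to `1 + (y / x) ^ 2`. -/
theorem abs_t_sub_le (hp : 1 ≤ F.prec) (hRN : F.IsRoundToNearest RN) (hyx : |y / x| ≤ 1)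
    (hsafe : StepsSafe F RN x y) {η : ℝ} (hη : |r RN x y - y / x| ≤ η) :
    |t RN x y - (1 + (y / x) ^ 2)| ≤ F.unitRoundoff + 2 * |y / x| * η + η ^ 2 := by
  obtain ⟨-, -, -, ht⟩ := r_t_bounds hp hRN hyx hsafe
  generalize y / x = q at *
  generalize r RN x y = r at *
  have e : t RN x y - (1 + q ^ 2) = (t RN x y - (1 + r ^ 2)) + (2 * q * (r - q) + (r - q) ^ 2) := by
    ring
  have e1 : |2 * q * (r - q)| ≤ 2 * |q| * η := by
    rw [abs_mul, abs_mul, abs_two]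
    gcongr
  have e2 : |(r - q) ^ 2| ≤ η ^ 2 := by
    rw [abs_pow]
    gcongr
  rw [e]
  refine (abs_add_le _ _).trans ?_
  have := abs_add_le (2 * q * (r - q)) ((r - q) ^ 2)
  linarith

/-- The relative rounding error of `t` with respect to `1 + (y / x) ^ 2`. -/
theorem abs_t_sub_le_mul (hF : F.unitRoundoff ≤ 1 / 16) (hRN : F.IsRoundToNearest RN)
    (hyx : |y / x| ≤ 1) (hsafe : StepsSafe F RN x y) :
    (1 / 2 ≤ |y / x| ∧ |t RN x y - (1 + (y / x) ^ 2)| ≤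
      (6 * F.unitRoundoff + F.unitRoundoff ^ 2) / 5 * (1 + (y / x) ^ 2)) ∨
    |t RN x y - (1 + (y / x) ^ 2)| ≤
      (53 / 50 * F.unitRoundoff + F.unitRoundoff ^ 2 / 16) * (1 + (y / x) ^ 2) := by
  have hp := prec_pos hF
  have hu := F.unitRoundoff_pos
  rcases le_or_gt (1 / 2) |y / x| with h | h
  · refine Or.inl ⟨h, ?_⟩
    have hη := hRN.abs_sub_le hp hsafe.1 (k := -1) (by simpa using hyx)
    refine (abs_t_sub_le hp hRN hyx hsafe hη).trans ?_
    have := perturbation_le_of_half_le hu.le h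
    rw [sq_abs] at this
    norm_num
    linarith
  · refine Or.inr ?_
    have hη := hRN.abs_sub_le hp hsafe.1 (k := -2) (by norm_num; linarith)
    refine (abs_t_sub_le hp hRN hyx hsafe hη).trans ?_
    have := perturbation_le_of_lt_half (q := |y / x|) hu.le
    rw [sq_abs] at this
    norm_num
    linarith

/-- The accuracy of the correction term `c`. -/
theorem c_bounds (hF : F.unitRoundoff ≤ 1 / 16) (hRN : F.IsRoundToNearest RN)
    (hyx : |y / x| ≤ 1) (hsafe : StepsSafe F RN x y) :
    s RN x y + c RN x y ≤ √(t RN x y) + F.unitRoundoff ^ 2 / (2 * s RN x y) +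
      F.unitRoundoff ^ 2 / 2 ∧
    √(t RN x y) - F.unitRoundoff ^ 2 / 2 ≤ s RN x y + c RN x y ∧
    |c RN x y| ≤ F.unitRoundoff + F.unitRoundoff ^ 2 / (2 * s RN x y) +
      F.unitRoundoff ^ 2 / 2 := by
  have hp := prec_pos hF
  obtain ⟨-, ht1, ht2, -⟩ := r_t_bounds hp hRN hyx hsafe
  obtain ⟨hs1, hst⟩ := s_bounds hp hRN hyx hsafe
  obtain ⟨-, -, -, h4, h5, -⟩ := hsafe
  have hu := F.unitRoundoff_pos
  have hε : ε RN x y = t RN x y - s RN x y ^ 2 :=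
    sqrt_residual_exact hF hRN (hRN _).1 (hRN _).1 ht1 ht2 hs1 hst h4
  have hc : c RN x y = RN (ε RN x y / (2 * s RN x y)) := rfl
  rw [hε] at h5 hc
  have hsq := Real.sq_sqrt (by linarith : 0 ≤ t RN x y)
  rw [hc]
  generalize t RN x y = t at *
  generalize s RN x y = s at *
  set u := F.unitRoundoff
  have hs0 : 0 < s := by linarith
  obtain ⟨hl, hr⟩ := abs_le.1 hst
  -- The Newton error is nonnegative, so `u²/(2s)` enters only the upper bound. It can push the
  -- quotient beyond `u`, but by at most `u²/2`, as `abs_round_sub_le_half_sq` allows.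
  have hz : (t - s ^ 2) / (2 * s) = √t - s + (√t - s) ^ 2 / (2 * s) := by
    field_simp
    linear_combination -hsq
  have hN0 : 0 ≤ (√t - s) ^ 2 / (2 * s) := by positivity
  have hN1 : (√t - s) ^ 2 / (2 * s) ≤ u ^ 2 / (2 * s) := by
    gcongr ?_ / _
    exact sq_le_sq' (by linarith) (by linarith)
  have hN2 : u ^ 2 / (2 * s) ≤ u ^ 2 / 2 := by
    gcongr
    linarith
  have herr := abs_round_sub_le_half_sq hF hRN h5 (by rw [hz]; linarith) (by rw [hz]; linarith)
  set C := RN ((t - s ^ 2) / (2 * s))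
  rw [hz] at herr
  obtain ⟨e1, e2⟩ := abs_le.1 herr
  refine ⟨by linarith, by linarith, abs_le.2 ⟨by linarith, by linarith⟩⟩

theorem sqrt_add_sq (hx : x ≠ 0) : √(x ^ 2 + y ^ 2) = |x| * √(1 + (y / x) ^ 2) := by
  rw [← Real.sqrt_sq_eq_abs, ← Real.sqrt_mul (sq_nonneg x)]
  congr 1
  field_simp

theorem s_add_correction_le (hF : F.unitRoundoff ≤ 1 / 16) (hRN : F.IsRoundToNearest RN)
    (hyx : |y / x| ≤ 1) (hsafe : StepsSafe F RN x y) :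
    s RN x y + c RN x y + F.unitRoundoff / (1 + F.unitRoundoff) * |c RN x y| ≤
      core F.unitRoundoff * √(1 + (y / x) ^ 2) := by
  have hp := prec_pos hF
  have hu := F.unitRoundoff_pos
  obtain ⟨-, ht1, ht2, -⟩ := r_t_bounds hp hRN hyx hsafe
  obtain ⟨hs1, hst⟩ := s_bounds hp hRN hyx hsafe
  obtain ⟨hc1, -, hc3⟩ := c_bounds hF hRN hyx hsafe
  have hq : 0 ≤ 1 + (y / x) ^ 2 := by positivity
  have hmain : √(t RN x y) + (1 + 2 * F.unitRoundoff) / (1 + F.unitRoundoff) *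
      (F.unitRoundoff ^ 2 / (2 * s RN x y) + F.unitRoundoff ^ 2 / 2) +
      F.unitRoundoff ^ 2 / (1 + F.unitRoundoff) ≤ core F.unitRoundoff * √(1 + (y / x) ^ 2) := by
    rcases abs_t_sub_le_mul hF hRN hyx hsafe with ⟨hh, ht⟩ | ht
    · refine core_bound_of_half_le hu.le hF ?_ (Real.one_le_sqrt.2 ht1) ?_
        (by linarith [(abs_le.1 hst).1])
      · refine Real.le_sqrt_of_sq_le ?_
        rw [div_pow, Real.sq_sqrt (by norm_num), ← sq_abs (y / x)]
        nlinarith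
      · rw [σ, ← Real.sqrt_mul (by positivity)]
        refine Real.sqrt_le_sqrt ?_
        linarith [(abs_le.1 ht).2]
    · refine core_bound_of_lt_half hu.le hF (Real.one_le_sqrt.2 (by simpa using sq_nonneg _)) ?_ hs1
      rw [← Real.sqrt_mul (by positivity)]
      refine Real.sqrt_le_sqrt ?_
      linarith [(abs_le.1 ht).2]
  refine le_trans ?_ hmain
  set u := F.unitRoundoff
  have hc4 := mul_le_mul_of_nonneg_left hc3 (by positivity : 0 ≤ u / (1 + u))
  have e : √(t RN x y) + (1 + 2 * u) / (1 + u) * (u ^ 2 / (2 * s RN x y) + u ^ 2 / 2) +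
      u ^ 2 / (1 + u) = √(t RN x y) + u ^ 2 / (2 * s RN x y) + u ^ 2 / 2 +
      u / (1 + u) * (u + u ^ 2 / (2 * s RN x y) + u ^ 2 / 2) := by
    field_simp
    ring
  rw [e]
  linarith

theorem le_s_add_correction (hF : F.unitRoundoff ≤ 1 / 16) (hRN : F.IsRoundToNearest RN)
    (hyx : |y / x| ≤ 1) (hsafe : StepsSafe F RN x y) :
    (1 - χ₄ F.unitRoundoff) * (1 + F.unitRoundoff) * √(1 + (y / x) ^ 2) ≤
    s RN x y + c RN x y - F.unitRoundoff / (1 + F.unitRoundoff) * |c RN x y| := by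
  have hp := prec_pos hF
  have hu := F.unitRoundoff_pos
  obtain ⟨hs1, hst⟩ := s_bounds hp hRN hyx hsafe
  obtain ⟨-, hc2, hc3⟩ := c_bounds hF hRN hyx hsafe
  have ht : |t RN x y - (1 + (y / x) ^ 2)| ≤
      (6 * F.unitRoundoff + F.unitRoundoff ^ 2) / 5 * (1 + (y / x) ^ 2) := by
    rcases abs_t_sub_le_mul hF hRN hyx hsafe with ⟨-, ht⟩ | ht
    · exact ht
    · refine ht.trans ?_
      gcongr
      nlinarith
  have hlow := one_sub_χ₄_le hu.le hF
  set u := F.unitRoundoff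
  have hv : 1 ≤ √(1 + (y / x) ^ 2) := Real.one_le_sqrt.2 (by simpa using sq_nonneg _)
  have hsqrt : √(1 - (6 * u + u ^ 2) / 5) * √(1 + (y / x) ^ 2) ≤ √(t RN x y) := by
    rw [← Real.sqrt_mul' _ (by positivity)]
    refine Real.sqrt_le_sqrt ?_
    linarith [(abs_le.1 ht).1]
  have hc4 : u / (1 + u) * |c RN x y| ≤ u ^ 2 := by
    have : u ^ 2 / (2 * s RN x y) ≤ u ^ 2 / 2 := by
      gcongr
      linarith
    calc u / (1 + u) * |c RN x y| ≤ u / (1 + u) * (u + u ^ 2) := by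
          gcongr
          linarith
      _ = u ^ 2 := by
          field_simp
  have := mul_le_mul_of_nonneg_right hlow (by linarith : 0 ≤ √(1 + (y / x) ^ 2))
  nlinarith [sq_nonneg u]

theorem abs_ρ_sub_le (hF : F.unitRoundoff ≤ 1 / 16) (hRN : F.IsRoundToNearest RN)
    (hx : x ≠ 0) (hyx : |y| ≤ |x|) (hsafe : StepsSafe F RN x y) :
    |ρ RN x y - √(x ^ 2 + y ^ 2)| / √(x ^ 2 + y ^ 2) ≤ χ₄ F.unitRoundoff := by
  have hp := prec_pos hF
  have hu := F.unitRoundoff_pos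
  have hx0 : 0 < |x| := abs_pos.2 hx
  have hq : |y / x| ≤ 1 := by
    rw [abs_div]
    exact (div_le_one hx0).2 hyx
  have hup := s_add_correction_le hF hRN hq hsafe
  have hlo := le_s_add_correction hF hRN hq hsafe
  obtain ⟨-, -, -, -, -, h6, h7⟩ := hsafe
  have hν : |ν RN x y - |x| * c RN x y| ≤ _ := hRN.abs_sub_le_relative hp h6
  have hρ : |ρ RN x y - (|x| * s RN x y + ν RN x y)| ≤ _ := hRN.abs_sub_le_relative hp h7
  have hv : 0 < √(1 + (y / x) ^ 2) := by positivity
  rw [sqrt_add_sq hx, div_le_iff₀ (by positivity)]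
  have hχ := χ₄_eq_core (by linarith : -1 / 2 < F.unitRoundoff)
  -- Needed to make `w` nonnegative, so that `|w|` can be replaced by `w` in the last rounding
  -- error.
  have hχ1 : χ₄ F.unitRoundoff ≤ 1 := by
    have := χ₄_le hu.le hF
    nlinarith
  set u := F.unitRoundoff
  set v := √(1 + (y / x) ^ 2)
  set w := |x| * s RN x y + ν RN x y with hw
  rw [abs_mul, abs_abs] at hν
  obtain ⟨hν1, hν2⟩ := abs_le.1 hν
  have hw1 : w ≤ |x| * (core u * v) := by
    have := mul_le_mul_of_nonneg_left hup hx0.le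
    rw [hw]
    linarith
  have hw2 : |x| * ((1 - χ₄ u) * (1 + u) * v) ≤ w := by
    have := mul_le_mul_of_nonneg_left hlo hx0.le
    rw [hw]
    linarith
  have hw0 : 0 ≤ w := by
    refine le_trans ?_ hw2
    have : 0 ≤ 1 - χ₄ u := by linarith
    positivity
  rw [abs_of_nonneg hw0] at hρ
  obtain ⟨hρ1, hρ2⟩ := abs_le.1 hρ
  refine abs_le.2 ⟨?_, ?_⟩
  -- From below, the last rounding multiplies by at least `1 - u/(1+u) = 1/(1+u)`, which cancels the
  -- factor `1 + u` in `hw2`.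
  · have h := mul_le_mul_of_nonneg_left hw2 (by positivity : 0 ≤ 1 / (1 + u))
    have e1 : 1 / (1 + u) * (|x| * ((1 - χ₄ u) * (1 + u) * v)) = |x| * v * (1 - χ₄ u) := by
      field_simp
    have e2 : 1 / (1 + u) * w = w - u / (1 + u) * w := by
      field_simp
      ring
    rw [e1, e2] at h
    linarith
  · have h := mul_le_mul_of_nonneg_left hw1 (by positivity : 0 ≤ (1 + 2 * u) / (1 + u))
    have e1 : (1 + 2 * u) / (1 + u) * (|x| * (core u * v)) = |x| * v * (χ₄ u + 1) := by
      rw [hχ]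
      ring
    have e2 : (1 + 2 * u) / (1 + u) * w = w + u / (1 + u) * w := by
      field_simp
      ring
    rw [e1, e2] at h
    linarith

end steps

end Beebe

theorem mainTheorem4 :
    (∀ (F : FPFormat) (RN : ℝ → ℝ), F.unitRoundoff ≤ 1 / 16 → F.IsRoundToNearest RN →
      ∀ x ∈ F.numbers, ∀ y ∈ F.numbers, (x ≠ 0 ∨ y ≠ 0) → Beebe.Safe F RN x y →
        |Beebe.hypot RN x y - √(x ^ 2 + y ^ 2)| / √(x ^ 2 + y ^ 2) ≤
          Beebe.χ₄ F.unitRoundoff) ∧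
    (fun u : ℝ => Beebe.χ₄ u - (8 / 5 * u + (3 * √5 / 5 - 2 / 25) * u ^ 2 +
        (116 / 125 + 14 * √5 / 25) * u ^ 3)) =O[𝓝 0] (fun u : ℝ => u ^ 4) ∧
    (∀ u ∈ Set.Icc (0 : ℝ) (1 / 16), Beebe.χ₄ u ≤ 8 / 5 * u + 7 / 5 * u ^ 2) ∧
    StrictMonoOn Beebe.χ₄ (Set.Icc (0 : ℝ) (1 / 16)) := by
  refine ⟨fun F RN hF hRN x _ y _ hxy hsafe => ?_, Beebe.χ₄_taylor,
    fun u hu => Beebe.χ₄_le hu.1 hu.2, Beebe.strictMonoOn_χ₄⟩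
  unfold Beebe.Safe at hsafe
  unfold Beebe.hypot
  split_ifs at hsafe ⊢ with h
  · rw [add_comm (x ^ 2)]
    exact Beebe.abs_ρ_sub_le hF hRN (abs_pos.1 ((abs_nonneg x).trans_lt h)) h.le hsafe
  · push Not at h
    refine Beebe.abs_ρ_sub_le hF hRN ?_ h hsafe
    rintro rfl
    rw [abs_zero, abs_nonpos_iff] at h
    simp [h] at hxy
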